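/- Fix countably many propositional variables $p_0,p_1,\dots$. A (normal) modal logic over a set of modalities is a set of modal formulas that contains all classical tautologies and, for each modality $\lozenge$, the formulas $\neg\lozenge\bot$ and $\lozenge(p\vee q)\to\lozenge p\vee\lozenge q$, and that is closed under modus ponens, substitution and monotonicity (from $\varphi\to\psi$ infer $\lozenge\varphi\to\lozenge\psi$). A unimodal logic has one modality $\lozenge$, a bimodal logic has two, $\lozenge_1$ and $\lozenge_2$; $\Box_i$ abbreviates $\neg\lozenge_i\neg$. For a logic $L$ and a formula $\varphi$, $L+\varphi$ is the smallest logic containing $L\cup\{\varphi\}$. A logic $L$ is *locally tabular* if for every $k<\omega$ there are only finitely many classes of formulas in the variables $p_0,\dots,p_{k-1}$ modulo the equivalence $\varphi\leftrightarrow\psi\in L$. It is *pre-locally tabular* if it is not locally tabular, but every logic over the same modalities that properly contains $L$ is. Let $\mathrm{S4}$ be the unimodal logic of all preorders and $\mathrm{Grz}$ the unimodal logic of all Noetherian posets (posets without infinite strictly ascending chains). For a unimodal logic $L$ let $L.3=L+\big(\lozenge p\wedge\lozenge q\to\lozenge(p\wedge\lozenge q)\vee\lozenge(q\wedge\lozenge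 p)\big)$. The fusion $L_1\otimes L_2$ of unimodal logics is the smallest bimodal logic containing $L_1$ written with $\lozenge_1$ and $L_2$ written with $\lozenge_2$. Let $$\mathrm{conv}=(\lozenge_1\Box_2p\to p)\wedge(\lozenge_2\Box_1p\to p),\qquad \mathrm{LinT}=(\mathrm{S4.3}\otimes\mathrm{S4.3})+\mathrm{conv},\qquad \mathrm{LinTGrz}=(\mathrm{Grz.3}\otimes\mathrm{Grz.3})+\mathrm{conv}.$$ **Theorem.** Every bimodal logic $L\supseteq\mathrm{LinT}$ is locally tabular or satisfies $L\subseteq\mathrm{LinTGrz}$. **Corollary.** $\mathrm{LinTGrz}$ is pre-locally tabular. -/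

import Mathlib

namespace ModalLog

/-- Modal formulas over an alphabet `O` of modalities, with variables `p_0, p_1, ...`;
`dia o` is the diamond of the modality `o`. The other Boolean connectives are abbreviations. -/
inductive Formula (O : Type) : Type
  | var : ℕ → Formula O
  | bot : Formula O
  | imp : Formula O → Formula O → Formula O
  | dia : O → Formula O → Formula O

namespace Formula

variable {O : Type}

def neg (φ : Formula O) : Formula O := imp φ bot

def or (φ ψ : Formula O) : Formula O := imp (neg φ) ψ

def and (φ ψ : Formula O) : Formula O := neg (imp φ (neg ψ))

def iff (φ ψ : Formula O) : Formula O := and (imp φ ψ) (imp ψ φ)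

def box (o : O) (φ : Formula O) : Formula O := neg (dia o (neg φ))

/-- Uniform substitution. -/
def subst (s : ℕ → Formula O) : Formula O → Formula O
  | var i => s i
  | bot => bot
  | imp φ ψ => imp (subst s φ) (subst s ψ)
  | dia o φ => dia o (subst s φ)

/-- Renaming of modalities along a map of alphabets. -/
def rename {O' : Type} (f : O → O') : Formula O → Formula O'
  | var i => var i
  | bot => bot
  | imp φ ψ => imp (rename f φ) (rename f ψ)
  | dia o φ => dia (f o) (rename f φ)

/-- Propositional truth value: the variables and the formulas `dia o φ` are the atoms. -/
def propEval (v : ℕ → Prop) (w : O → Formula O → Prop) : Formula O → Prop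
  | var i => v i
  | bot => False
  | imp φ ψ => propEval v w φ → propEval v w ψ
  | dia o φ => w o φ

/-- Classical tautologies (modal formulas of the form `dia o φ` are treated as atoms). -/
def IsTautology (φ : Formula O) : Prop :=
  ∀ (v : ℕ → Prop) (w : O → Formula O → Prop), propEval v w φ

/-- `k`-formulas: all variables are among `p_0, ..., p_{k-1}`. -/
def IsKFormula (k : ℕ) : Formula O → Prop
  | var i => i < k
  | bot => True
  | imp φ ψ => IsKFormula k φ ∧ IsKFormula k ψ
  | dia _ φ => IsKFormula k φ

end Formula

open Formula in
/-- Normal modal logics with alphabet `O`. -/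
structure IsLogic {O : Type} (L : Set (Formula O)) : Prop where
  taut : ∀ φ : Formula O, φ.IsTautology → φ ∈ L
  dia_bot : ∀ o : O, neg (dia o bot) ∈ L
  dia_or : ∀ o : O,
    imp (dia o (or (var 0) (var 1))) (or (dia o (var 0)) (dia o (var 1))) ∈ L
  mp : ∀ φ ψ : Formula O, imp φ ψ ∈ L → φ ∈ L → ψ ∈ L
  subst : ∀ (s : ℕ → Formula O) (φ : Formula O), φ ∈ L → φ.subst s ∈ L
  mono : ∀ (o : O) (φ ψ : Formula O), imp φ ψ ∈ L → imp (dia o φ) (dia o ψ) ∈ L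

/-- The smallest modal logic that contains `Γ` (the intersection of all such logics). -/
def smallestLogic {O : Type} (Γ : Set (Formula O)) : Set (Formula O) :=
  {φ | ∀ L : Set (Formula O), IsLogic L → Γ ⊆ L → φ ∈ L}

/-- `L + φ`. -/
def addAxiom {O : Type} (L : Set (Formula O)) (φ : Formula O) : Set (Formula O) :=
  smallestLogic (L ∪ {φ})

/-- `φ` and `ψ` are `L`-equivalent. -/
def LEquiv {O : Type} (L : Set (Formula O)) (φ ψ : Formula O) : Prop :=
  Formula.iff φ ψ ∈ L

/-- The `L`-equivalence classes in the set of all `k`-formulas. -/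
def equivClasses {O : Type} (L : Set (Formula O)) (k : ℕ) : Set (Set (Formula O)) :=
  {C | ∃ φ : Formula O, φ.IsKFormula k ∧ C = {ψ | ψ.IsKFormula k ∧ LEquiv L φ ψ}}

def KFinite {O : Type} (k : ℕ) (L : Set (Formula O)) : Prop :=
  (equivClasses L k).Finite

def LocallyTabular {O : Type} (L : Set (Formula O)) : Prop :=
  ∀ k : ℕ, KFinite k L

def PreLocallyTabular {O : Type} (L : Set (Formula O)) : Prop :=
  IsLogic L ∧ ¬ LocallyTabular L ∧
    ∀ L' : Set (Formula O), IsLogic L' → L ⊂ L' → LocallyTabular L'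

/-- Kripke frames with alphabet `O`. -/
structure KripkeFrame (O : Type) : Type 1 where
  X : Type
  R : O → X → X → Prop

/-- Truth of a formula at a point of a Kripke model. -/
def Sat {O : Type} (F : KripkeFrame O) (θ : ℕ → Set F.X) : F.X → Formula O → Prop
  | x, .var i => x ∈ θ i
  | _, .bot => False
  | x, .imp φ ψ => Sat F θ x φ → Sat F θ x ψ
  | x, .dia o φ => ∃ y, F.R o x y ∧ Sat F θ y φ

/-- Validity in a Kripke frame. -/
def Valid {O : Type} (F : KripkeFrame O) (φ : Formula O) : Prop :=
  ∀ (θ : ℕ → Set F.X) (x : F.X), Sat F θ x φ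

/-- The logic of a class of Kripke frames. -/
def Log {O : Type} (C : Set (KripkeFrame O)) : Set (Formula O) :=
  {φ | ∀ F ∈ C, Valid F φ}

/-- The logic of all preorders. -/
def S4 : Set (Formula Unit) :=
  Log {F | (∀ x, F.R () x x) ∧ ∀ x y z, F.R () x y → F.R () y z → F.R () x z}

/-- Grzegorczyk's logic: the logic of all Noetherian posets, that is, of the posets `(X, ≤)`
whose converse strict order is well-founded (there is no infinite strictly ascending chain). -/
def Grz : Set (Formula Unit) :=
  Log {F | (∀ x, F.R () x x) ∧ (∀ x y z, F.R () x y → F.R () y z → F.R () x z) ∧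
    (∀ x y, F.R () x y → F.R () y x → x = y) ∧
    WellFounded (fun x y => F.R () y x ∧ x ≠ y)}

open Formula in
/-- The formula `◇p ∧ ◇q → ◇(p ∧ ◇q) ∨ ◇(q ∧ ◇p)`. -/
def linAxiom : Formula Unit :=
  imp (and (dia () (var 0)) (dia () (var 1)))
    (or (dia () (and (var 0) (dia () (var 1)))) (dia () (and (var 1) (dia () (var 0)))))

/-- `L.3`. -/
def dotThree (L : Set (Formula Unit)) : Set (Formula Unit) :=
  addAxiom L linAxiom

/-- The fusion of two unimodal logics. In the bimodal alphabet `Fin 2`, the modality `0` is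
the first one and `1` is the second one. -/
def fusion (L₁ L₂ : Set (Formula Unit)) : Set (Formula (Fin 2)) :=
  smallestLogic
    (Formula.rename (fun _ => (0 : Fin 2)) '' L₁ ∪ Formula.rename (fun _ => (1 : Fin 2)) '' L₂)

open Formula in
/-- The formula `(◇₁□₂p → p) ∧ (◇₂□₁p → p)`. -/
def conv : Formula (Fin 2) :=
  and (imp (dia 0 (box 1 (var 0))) (var 0)) (imp (dia 1 (box 0 (var 0))) (var 0))

/-- The linear tense logic: the fusion of `S4.3` with itself, plus `conv`. -/
def LinT : Set (Formula (Fin 2)) :=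
  addAxiom (fusion (dotThree S4) (dotThree S4)) conv

/-- The fusion of `Grz.3` with itself, plus `conv`. -/
def LinTGrz : Set (Formula (Fin 2)) :=
  addAxiom (fusion (dotThree Grz) (dotThree Grz)) conv

end ModalLog

/-! Everything rests on finite chains, whose logic is exactly `LinTGrz`. Suppose some formula of an
extension L of `LinT` fails in the n-chain. Extensions of `LinT` are complete for models on linear
preorders (`exists_linear_model`). If such a model of L had n points pairwise distinguished by
diamond formulas, finitely many definable upsets would separate them and collapse the model onto the
n-chain; all fibres being definable, the chain would validate L (`valid_chain_of_not_modalEquiv`).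
So at most n modal types occur, k-formulas are evaluated in models on one fixed finite set, and L is
locally tabular. Otherwise every finite chain validates L, and L lies in `LinTGrz` by completeness
(`mem_linTGrz_of_valid_chain`): a refuting linear model is cut into finitely many intervals on which
the relevant diamonds are constant, and the Grzegorczyk axiom supplies a "last" and a "first" point
of each, enough to witness all diamonds. `LinTGrz` itself is not locally tabular because one
variable can count alternations along chains. -/

namespace ModalLog

/-! ### Kripke semantics and generated logics. -/

section Semantics

variable {O : Type} {F : KripkeFrame O} {θ : ℕ → Set F.X} {x : F.X} {φ ψ : Formula O}

@[simp] theorem sat_var {i : ℕ} : Sat F θ x (.var i) ↔ x ∈ θ i := Iff.rfl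

@[simp] theorem sat_bot : ¬ Sat F θ x .bot := id

@[simp] theorem sat_imp : Sat F θ x (.imp φ ψ) ↔ (Sat F θ x φ → Sat F θ x ψ) := Iff.rfl

@[simp] theorem sat_dia {o : O} : Sat F θ x (.dia o φ) ↔ ∃ y, F.R o x y ∧ Sat F θ y φ := Iff.rfl

@[simp] theorem sat_neg : Sat F θ x φ.neg ↔ ¬ Sat F θ x φ := Iff.rfl

@[simp] theorem sat_or : Sat F θ x (φ.or ψ) ↔ Sat F θ x φ ∨ Sat F θ x ψ := by
  simp only [Formula.or, sat_imp, sat_neg]; tauto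

@[simp] theorem sat_and : Sat F θ x (φ.and ψ) ↔ Sat F θ x φ ∧ Sat F θ x ψ := by
  simp only [Formula.and, sat_imp, sat_neg]; tauto

@[simp] theorem sat_iff : Sat F θ x (φ.iff ψ) ↔ (Sat F θ x φ ↔ Sat F θ x ψ) := by
  simp only [Formula.iff, sat_imp, sat_and]; tauto

@[simp] theorem sat_box {o : O} : Sat F θ x (φ.box o) ↔ ∀ y, F.R o x y → Sat F θ y φ := by
  simp [Formula.box]

theorem sat_subst (s : ℕ → Formula O) (φ : Formula O) (x : F.X) :
    Sat F θ x (φ.subst s) ↔ Sat F (fun i => {y | Sat F θ y (s i)}) x φ := by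
  induction φ generalizing x with
  | var i => rfl
  | bot => rfl
  | imp φ ψ h₁ h₂ => simp only [Formula.subst, sat_imp, h₁, h₂]
  | dia o φ h => simp only [Formula.subst, sat_dia, h]

theorem sat_rename {O' : Type} {F : KripkeFrame O'} {θ : ℕ → Set F.X} (f : O → O')
    (φ : Formula O) (x : F.X) :
    Sat F θ x (φ.rename f) ↔ Sat ⟨F.X, fun o => F.R (f o)⟩ θ x φ := by
  induction φ generalizing x with
  | var i => rfl
  | bot => rfl
  | imp φ ψ h₁ h₂ => simp only [Formula.rename, sat_imp, h₁, h₂]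
  | dia o φ h => simp only [Formula.rename, sat_dia, h]

theorem sat_iff_propEval (φ : Formula O) :
    Sat F θ x φ ↔ φ.propEval (fun i => x ∈ θ i) (fun o ψ => Sat F θ x (.dia o ψ)) := by
  induction φ with
  | var i => rfl
  | bot => rfl
  | imp φ ψ h₁ h₂ => simp only [Formula.propEval, sat_imp, h₁, h₂]
  | dia o φ h => rfl

/-- Truth is invariant under bounded morphisms. -/
theorem sat_boundedMorphism {G : KripkeFrame O} {η : ℕ → Set G.X} (f : F.X → G.X)
    (forth : ∀ o x y, F.R o x y → G.R o (f x) (f y))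
    (back : ∀ o x z, G.R o (f x) z → ∃ y, F.R o x y ∧ f y = z) (φ : Formula O) (x : F.X) :
    Sat F (fun i => f ⁻¹' η i) x φ ↔ Sat G η (f x) φ := by
  induction φ generalizing x with
  | var i => rfl
  | bot => rfl
  | imp φ ψ h₁ h₂ => simp only [sat_imp, h₁, h₂]
  | dia o φ h =>
    simp only [sat_dia, h]
    constructor
    · rintro ⟨y, hxy, hy⟩
      exact ⟨f y, forth o x y hxy, hy⟩
    · rintro ⟨z, hxz, hz⟩
      obtain ⟨y, hxy, rfl⟩ := back o x z hxz
      exact ⟨y, hxy, hz⟩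

theorem isLogic_log (C : Set (KripkeFrame O)) : IsLogic (Log C) where
  taut φ h F _ θ x := (sat_iff_propEval φ).2 (h _ _)
  dia_bot o F _ θ x := by simp
  dia_or o F _ θ x := by
    simp only [sat_imp, sat_dia, sat_or]
    rintro ⟨y, hxy, h | h⟩
    exacts [Or.inl ⟨y, hxy, h⟩, Or.inr ⟨y, hxy, h⟩]
  mp φ ψ h₁ h₂ F hF θ x := h₁ F hF θ x (h₂ F hF θ x)
  subst s φ h F hF θ x := (sat_subst s φ x).2 (h F hF _ x)
  mono o φ ψ h F hF θ x := fun ⟨y, hxy, hy⟩ => ⟨y, hxy, h F hF θ y hy⟩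

theorem isLogic_smallestLogic (Γ : Set (Formula O)) : IsLogic (smallestLogic Γ) where
  taut φ h _ hL _ := hL.taut φ h
  dia_bot o _ hL _ := hL.dia_bot o
  dia_or o _ hL _ := hL.dia_or o
  mp φ ψ h₁ h₂ L hL hΓ := hL.mp φ ψ (h₁ L hL hΓ) (h₂ L hL hΓ)
  subst s φ h L hL hΓ := hL.subst s φ (h L hL hΓ)
  mono o φ ψ h L hL hΓ := hL.mono o φ ψ (h L hL hΓ)

theorem subset_smallestLogic (Γ : Set (Formula O)) : Γ ⊆ smallestLogic Γ :=
  fun _ h _ _ hΓ => hΓ h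

theorem smallestLogic_subset {Γ L : Set (Formula O)} (hL : IsLogic L) (h : Γ ⊆ L) :
    smallestLogic Γ ⊆ L :=
  fun _ hφ => hφ L hL h

theorem smallestLogic_mono {Γ Γ' : Set (Formula O)} (h : Γ ⊆ Γ') :
    smallestLogic Γ ⊆ smallestLogic Γ' :=
  smallestLogic_subset (isLogic_smallestLogic _) (h.trans (subset_smallestLogic _))

end Semantics

/-! ### Canonical models. -/

section Canonical

variable {O : Type}

/-- Derivability from hypotheses by modus ponens, with the theorems of `L` as axioms. -/
inductive Derives (L Γ : Set (Formula O)) : Formula O → Prop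
  | thm {φ : Formula O} : φ ∈ L → Derives L Γ φ
  | hyp {φ : Formula O} : φ ∈ Γ → Derives L Γ φ
  | mp {φ ψ : Formula O} : Derives L Γ (.imp φ ψ) → Derives L Γ φ → Derives L Γ ψ

variable {L : Set (Formula O)}

/-- Deduction theorem. It holds because modus ponens is the only rule in `Derives`; monotonicity and
substitution act only inside `L`. -/
theorem Derives.imp_intro (hL : IsLogic L) {Γ : Set (Formula O)} {φ ψ : Formula O}
    (h : Derives L (insert φ Γ) ψ) : Derives L Γ (.imp φ ψ) := by
  induction h with
  | @thm ψ h =>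
    refine .mp (.thm (hL.taut (.imp ψ (.imp φ ψ)) fun v w => ?_)) (.thm h)
    simp only [Formula.propEval]; tauto
  | @hyp ψ h =>
    rcases h with rfl | h
    · exact .thm (hL.taut _ fun v w => id)
    · refine .mp (.thm (hL.taut (.imp ψ (.imp φ ψ)) fun v w => ?_)) (.hyp h)
      simp only [Formula.propEval]; tauto
  | @mp ψ χ _ _ h₁ h₂ =>
    refine .mp (.mp (.thm (hL.taut (.imp (.imp φ (.imp ψ χ)) (.imp (.imp φ ψ) (.imp φ χ)))
      fun v w => ?_)) h₁) h₂
    simp only [Formula.propEval]; tauto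

theorem Derives.exists_of_sUnion {c : Set (Set (Formula O))} (hc : IsChain (· ⊆ ·) c)
    (hne : c.Nonempty) {φ : Formula O} (h : Derives L (⋃₀ c) φ) : ∃ Γ ∈ c, Derives L Γ φ := by
  have mono : ∀ {Γ Γ' : Set (Formula O)} {ψ : Formula O}, Γ ⊆ Γ' → Derives L Γ ψ →
      Derives L Γ' ψ := by
    intro Γ Γ' ψ hs h
    induction h with
    | thm h => exact .thm h
    | hyp h => exact .hyp (hs h)
    | mp _ _ h₁ h₂ => exact .mp h₁ h₂
  induction h with
  | thm h => exact ⟨_, hne.some_mem, .thm h⟩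
  | hyp h =>
    obtain ⟨Γ, hΓ, h⟩ := h
    exact ⟨Γ, hΓ, .hyp h⟩
  | mp _ _ h₁ h₂ =>
    obtain ⟨Γ₁, hΓ₁, h₁⟩ := h₁
    obtain ⟨Γ₂, hΓ₂, h₂⟩ := h₂
    rcases hc.total hΓ₁ hΓ₂ with h | h
    · exact ⟨Γ₂, hΓ₂, .mp (mono h h₁) h₂⟩
    · exact ⟨Γ₁, hΓ₁, .mp h₁ (mono h h₂)⟩

/-- Maximal `L`-consistent sets. -/
def IsMaxConsistent (L x : Set (Formula O)) : Prop :=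
  Maximal (fun Γ => ¬ Derives L Γ .bot) x

theorem exists_isMaxConsistent {Γ : Set (Formula O)} (h : ¬ Derives L Γ .bot) :
    ∃ x, Γ ⊆ x ∧ IsMaxConsistent L x := by
  refine zorn_subset_nonempty {Γ | ¬ Derives L Γ .bot} (fun c hc hch hne => ?_) Γ h
  refine ⟨⋃₀ c, fun hd => ?_, fun s hs => Set.subset_sUnion_of_mem hs⟩
  obtain ⟨Δ, hΔ, hd⟩ := hd.exists_of_sUnion hch hne
  exact hc hΔ hd

namespace IsMaxConsistent

variable {x : Set (Formula O)} {φ ψ : Formula O}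

theorem bot_notMem (hx : IsMaxConsistent L x) : Formula.bot ∉ x :=
  fun h => hx.prop (.hyp h)

theorem mem_of_derives (hL : IsLogic L) (hx : IsMaxConsistent L x) (h : Derives L x φ) :
    φ ∈ x := by
  refine hx.2 (y := insert φ x) (fun hd => hx.prop ?_) (Set.subset_insert _ _)
    (Set.mem_insert _ _)
  exact .mp (hd.imp_intro hL) h

theorem imp_mem_iff (hL : IsLogic L) (hx : IsMaxConsistent L x) :
    Formula.imp φ ψ ∈ x ↔ (φ ∈ x → ψ ∈ x) := by
  refine ⟨fun h h' => hx.mem_of_derives hL (.mp (.hyp h) (.hyp h')), fun h => ?_⟩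
  by_cases hφ : φ ∈ x
  · refine hx.mem_of_derives hL (.mp (.thm (hL.taut (.imp ψ (.imp φ ψ)) fun v w => ?_))
      (.hyp (h hφ)))
    simp only [Formula.propEval]; tauto
  · have hd : Derives L (insert φ x) .bot := by
      by_contra hd
      exact hφ (hx.2 (y := insert φ x) hd (Set.subset_insert _ _) (Set.mem_insert _ _))
    refine hx.mem_of_derives hL (.mp (.thm (hL.taut (.imp (.imp φ .bot) (.imp φ ψ))
      fun v w => ?_)) (hd.imp_intro hL))
    simp only [Formula.propEval]; tauto

theorem neg_mem_iff (hL : IsLogic L) (hx : IsMaxConsistent L x) : φ.neg ∈ x ↔ φ ∉ x := by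
  rw [Formula.neg, hx.imp_mem_iff hL]
  exact ⟨fun h h' => hx.bot_notMem (h h'), fun h h' => absurd h' h⟩

theorem mem_of_imp (hL : IsLogic L) (hx : IsMaxConsistent L x) (h : Formula.imp φ ψ ∈ L)
    (hφ : φ ∈ x) : ψ ∈ x :=
  hx.mem_of_derives hL (.mp (.thm h) (.hyp hφ))

end IsMaxConsistent

theorem IsLogic.box_mem (hL : IsLogic L) {φ : Formula O} (h : φ ∈ L) (o : O) : φ.box o ∈ L := by
  have h₁ : Formula.imp φ.neg .bot ∈ L := by
    refine hL.mp φ _ (hL.taut _ fun v w => ?_) h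
    simp only [Formula.propEval, Formula.neg]; tauto
  refine hL.mp _ _ (hL.mp _ _ (hL.taut (.imp (.imp (.dia o φ.neg) (.dia o .bot))
    (.imp (Formula.neg (.dia o .bot)) (φ.box o))) fun v w => ?_) (hL.mono o _ _ h₁))
    (hL.dia_bot o)
  simp only [Formula.propEval, Formula.neg, Formula.box]; tauto

theorem IsLogic.dia_or_mem (hL : IsLogic L) (o : O) (φ ψ : Formula O) :
    Formula.imp (.dia o (φ.or ψ)) (Formula.or (.dia o φ) (.dia o ψ)) ∈ L :=
  hL.subst (fun i => if i = 0 then φ else ψ) _ (hL.dia_or o)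

/-- Every diamond in a maximal consistent set has a witness. -/
theorem IsMaxConsistent.exists_successor (hL : IsLogic L) {x : Set (Formula O)}
    (hx : IsMaxConsistent L x) {o : O} {φ : Formula O} (h : Formula.dia o φ ∈ x) :
    ∃ y, IsMaxConsistent L y ∧ (∀ χ ∈ y, Formula.dia o χ ∈ x) ∧ φ ∈ y := by
  have hnn : ∀ ψ : Formula O, Formula.imp (.dia o ψ) (.dia o ψ.neg.neg) ∈ L := fun ψ =>
    hL.mono o _ _ (hL.taut _ fun v w => by simp only [Formula.propEval, Formula.neg]; tauto)
  have hbox : ∀ ψ, Derives L {χ | χ.box o ∈ x} ψ → ψ.box o ∈ x := by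
    intro ψ hd
    induction hd with
    | thm h => exact hx.mem_of_derives hL (.thm (hL.box_mem h o))
    | hyp h => exact h
    -- Normality of the box, from additivity of the diamond: ¬χ implies ¬(ψ → χ) ∨ ¬ψ.
    | @mp ψ χ _ _ h₁ h₂ =>
      rw [Formula.box, hx.neg_mem_iff hL] at h₁ h₂ ⊢
      intro h₃
      have h₄ : Formula.imp (.dia o χ.neg) (.dia o ((Formula.imp ψ χ).neg.or ψ.neg)) ∈ L :=
        hL.mono o _ _ (hL.taut _ fun v w => by
          simp only [Formula.propEval, Formula.neg, Formula.or]; tauto)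
      have h₅ := hx.mem_of_imp hL (hL.dia_or_mem o _ _) (hx.mem_of_imp hL h₄ h₃)
      rw [Formula.or, hx.imp_mem_iff hL, hx.neg_mem_iff hL] at h₅
      exact h₂ (h₅ h₁)
  obtain ⟨y, hy, hmax⟩ := exists_isMaxConsistent (L := L)
    (Γ := insert φ {χ | χ.box o ∈ x}) fun hd => by
      have h₁ := hbox _ (hd.imp_intro hL)
      rw [Formula.box, hx.neg_mem_iff hL] at h₁
      exact h₁ (hx.mem_of_imp hL (hnn φ) h)
  refine ⟨y, hmax, fun χ hχ => ?_, hy (Set.mem_insert _ _)⟩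
  by_contra hd
  have h₁ : χ.neg ∈ y := by
    refine hy (Set.mem_insert_of_mem _ ?_)
    rw [Set.mem_ofPred_eq, Formula.box, hx.neg_mem_iff hL]
    intro h₂
    refine hd (hx.mem_of_imp hL (hL.mono o _ _ (hL.taut _ fun v w => ?_)) h₂)
    simp only [Formula.propEval, Formula.neg]; tauto
  exact (hmax.neg_mem_iff hL).1 h₁ hχ

/-- The canonical frame of `L`. -/
def canonicalFrame (L : Set (Formula O)) : KripkeFrame O where
  X := {x : Set (Formula O) // IsMaxConsistent L x}
  R o x y := ∀ χ ∈ y.1, Formula.dia o χ ∈ x.1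

/-- The canonical valuation of `L`. -/
def canonicalVal (L : Set (Formula O)) : ℕ → Set (canonicalFrame L).X :=
  fun i => {x | Formula.var i ∈ x.1}

theorem sat_canonical (hL : IsLogic L) (φ : Formula O) (x : (canonicalFrame L).X) :
    Sat (canonicalFrame L) (canonicalVal L) x φ ↔ φ ∈ x.1 := by
  induction φ generalizing x with
  | var i => rfl
  | bot => exact iff_of_false id x.2.bot_notMem
  | imp φ ψ h₁ h₂ => rw [sat_imp, h₁, h₂, x.2.imp_mem_iff hL]
  | dia o φ h =>
    simp only [sat_dia, h]
    constructor
    · rintro ⟨y, hxy, hy⟩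
      exact hxy φ hy
    · intro hx
      obtain ⟨y, hy, hxy, hφ⟩ := x.2.exists_successor hL hx
      exact ⟨⟨y, hy⟩, hxy, hφ⟩

theorem exists_canonical_refuting (hL : IsLogic L) {φ : Formula O} (hφ : φ ∉ L) :
    ∃ x, ¬ Sat (canonicalFrame L) (canonicalVal L) x φ := by
  obtain ⟨x, hx, hmax⟩ := exists_isMaxConsistent (L := L) (Γ := {φ.neg}) fun hd => by
    have h₁ : Derives L ∅ φ.neg.neg := by
      refine Derives.imp_intro hL ?_
      simpa using hd
    have h₂ : ∀ ψ, Derives L ∅ ψ → ψ ∈ L := by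
      intro ψ h
      induction h with
      | thm h => exact h
      | hyp h => exact h.elim
      | mp _ _ h h' => exact hL.mp _ _ h h'
    refine hφ (hL.mp _ _ (hL.taut _ fun v w => ?_) (h₂ _ h₁))
    simp only [Formula.propEval, Formula.neg]; tauto
  exact ⟨⟨x, hmax⟩, fun h => (hmax.neg_mem_iff hL).1 (hx rfl) ((sat_canonical hL φ _).1 h)⟩

theorem sat_canonical_of_mem (hL : IsLogic L) {φ : Formula O} (hφ : φ ∈ L)
    (x : (canonicalFrame L).X) : Sat (canonicalFrame L) (canonicalVal L) x φ :=
  (sat_canonical hL φ x).2 (x.2.mem_of_derives hL (.thm hφ))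

/-- By the truth lemma, accessibility becomes purely semantic, so frame conditions follow from the
truth of axiom instances without further syntactic derivations. -/
theorem canonical_rel_iff (hL : IsLogic L) {o : O} {x y : (canonicalFrame L).X} :
    (canonicalFrame L).R o x y ↔ ∀ χ, Sat (canonicalFrame L) (canonicalVal L) y χ →
      Sat (canonicalFrame L) (canonicalVal L) x (.dia o χ) := by
  simp only [sat_canonical hL]
  rfl

end Canonical

/-! ### Linear models for extensions of `LinT`. -/

section Tense

theorem rename_mem_addAxiom_fusion {L : Set (Formula Unit)} {χ : Formula (Fin 2)}
    {φ : Formula Unit} (h : φ ∈ L) (o : Fin 2) :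
    φ.rename (fun _ => o) ∈ addAxiom (fusion L L) χ := by
  refine subset_smallestLogic _ (Or.inl (subset_smallestLogic _ ?_))
  fin_cases o
  · exact Or.inl ⟨φ, h, rfl⟩
  · exact Or.inr ⟨φ, h, rfl⟩

theorem mem_dotThree {L : Set (Formula Unit)} {φ : Formula Unit} (h : φ ∈ L) : φ ∈ dotThree L :=
  subset_smallestLogic _ (Or.inl h)

theorem linAxiom_mem_dotThree (L : Set (Formula Unit)) : linAxiom ∈ dotThree L :=
  subset_smallestLogic _ (Or.inr rfl)

theorem mem_addAxiom {O : Type} (L : Set (Formula O)) (φ : Formula O) : φ ∈ addAxiom L φ :=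
  subset_smallestLogic _ (Or.inr rfl)

theorem linT_subset_linTGrz : LinT ⊆ LinTGrz := by
  have h₁ : S4 ⊆ Grz := fun φ h F hF => h F ⟨hF.1, hF.2.1⟩
  have h₂ : dotThree S4 ⊆ dotThree Grz := smallestLogic_mono (Set.union_subset_union_left _ h₁)
  exact smallestLogic_mono (Set.union_subset_union_left _ (smallestLogic_mono
    (Set.union_subset_union (Set.image_mono h₂) (Set.image_mono h₂))))

/-- Linear preorders with the converse relation. -/
structure IsLinear (F : KripkeFrame (Fin 2)) : Prop where
  refl : ∀ o x, F.R o x x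
  trans : ∀ o x y z, F.R o x y → F.R o y z → F.R o x z
  total : ∀ o x y, F.R o x y ∨ F.R o y x
  converse : ∀ x y, F.R 1 x y ↔ F.R 0 y x

/-- The canonical frame of an extension of `LinT` is a preorder with its converse, and is linear
upwards and downwards. -/
theorem canonical_of_linT {L : Set (Formula (Fin 2))} (hL : IsLogic L) (hT : LinT ⊆ L) :
    (∀ o x, (canonicalFrame L).R o x x) ∧
    (∀ o x y z, (canonicalFrame L).R o x y → (canonicalFrame L).R o y z →
      (canonicalFrame L).R o x z) ∧
    (∀ x y, (canonicalFrame L).R 1 x y ↔ (canonicalFrame L).R 0 y x) ∧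
    (∀ o x y z, (canonicalFrame L).R o x y → (canonicalFrame L).R o x z →
      (canonicalFrame L).R o y z ∨ (canonicalFrame L).R o z y) := by
  have hren : ∀ (o : Fin 2) (φ : Formula Unit), φ ∈ dotThree S4 →
      ∀ (s : ℕ → Formula (Fin 2)) (x : (canonicalFrame L).X),
      Sat (canonicalFrame L) (canonicalVal L) x ((φ.rename fun _ => o).subst s) :=
    fun o φ h s => sat_canonical_of_mem hL (hL.subst s _ (hT (rename_mem_addAxiom_fusion h o)))
  have hrefl : ∀ o x, (canonicalFrame L).R o x x := by
    intro o x
    rw [canonical_rel_iff hL]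
    intro χ
    -- `S4` is defined semantically, so its reflexivity axiom is obtained by checking validity in
    -- preorders.
    refine hren o (.imp (.var 0) (.dia () (.var 0))) (mem_dotThree fun F hF θ x hx => ?_)
      (fun _ => χ) x
    exact ⟨x, hF.1 x, hx⟩
  have hconv : ∀ χ x, Sat (canonicalFrame L) (canonicalVal L) x (conv.subst fun _ => χ) :=
    fun χ => sat_canonical_of_mem hL (hL.subst _ _ (hT (mem_addAxiom _ _)))
  simp only [sat_subst, conv, sat_and, sat_imp, sat_dia, sat_box, sat_var, Set.mem_ofPred_eq]
    at hconv
  refine ⟨hrefl, ?_, ?_, ?_⟩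
  · intro o x y z hxy hyz
    rw [canonical_rel_iff hL]
    intro χ hχ
    refine hren o (.imp (.dia () (.dia () (.var 0))) (.dia () (.var 0)))
      (mem_dotThree fun F hF θ x => ?_) (fun _ => χ) x ⟨y, hxy, z, hyz, hχ⟩
    rintro ⟨y, hxy, z, hyz, h⟩
    exact ⟨z, hF.2 _ _ _ hxy hyz, h⟩
  · intro x y
    constructor
    · intro hxy
      rw [canonical_rel_iff hL]
      intro χ hχ
      by_contra hd
      exact (hconv χ.neg x).2 ⟨y, hxy, fun z hyz hz => hd ⟨z, hyz, hz⟩⟩ hχ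
    · intro hyx
      rw [canonical_rel_iff hL]
      intro χ hχ
      by_contra hd
      exact (hconv χ.neg y).1 ⟨x, hyx, fun z hyz hz => hd ⟨z, hyz, hz⟩⟩ hχ
  · intro o x y z hxy hxz
    by_contra! h
    rw [canonical_rel_iff hL, canonical_rel_iff hL] at h
    push Not at h
    obtain ⟨⟨χ, hzχ, hyχ⟩, ξ, hyξ, hzξ⟩ := h
    -- If y and z are incomparable, ξ ∧ ¬◇χ holds at y and χ ∧ ¬◇ξ at z; linearity would then make
    -- one of these true at a point seeing the other, which is contradictory.
    have h₁ := hren o linAxiom (linAxiom_mem_dotThree _)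
      (fun i => if i = 0 then ξ.and (Formula.dia o χ).neg else χ.and (Formula.dia o ξ).neg) x
    rw [sat_subst, sat_rename] at h₁
    simp only [linAxiom, sat_imp, sat_and, sat_or, sat_dia, sat_var, Set.mem_ofPred_eq,
      if_true, one_ne_zero, if_false, sat_neg] at h₁
    rcases h₁ ⟨⟨y, hxy, hyξ, hyχ⟩, z, hxz, hzχ, hzξ⟩ with h₂ | h₂
    · obtain ⟨u, -, ⟨-, hu⟩, v, huv, hv, -⟩ := h₂
      exact hu ⟨v, huv, hv⟩
    · obtain ⟨u, -, ⟨-, hu⟩, v, huv, hv, -⟩ := h₂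
      exact hu ⟨v, huv, hv⟩

/-- Extensions of `LinT` are complete with respect to models on linear preorders. -/
theorem exists_linear_model {L : Set (Formula (Fin 2))} (hL : IsLogic L) (hT : LinT ⊆ L)
    {φ : Formula (Fin 2)} (hφ : φ ∉ L) :
    ∃ (F : KripkeFrame (Fin 2)) (θ : ℕ → Set F.X), IsLinear F ∧
      (∀ ψ ∈ L, ∀ x, Sat F θ x ψ) ∧ ∃ x, ¬ Sat F θ x φ := by
  obtain ⟨w, hw⟩ := exists_canonical_refuting hL hφ
  obtain ⟨hrefl, htrans, hconv, hlin⟩ := canonical_of_linT hL hT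
  have hlin0 := hlin 0
  have hlin1 := hlin 1
  have htr := htrans 0
  simp only [hconv] at hlin1
  -- The points comparable with the refuting point w. Upward and downward linearity make this set
  -- closed under both relations and total.
  let F : KripkeFrame (Fin 2) :=
    ⟨{v // (canonicalFrame L).R 0 w v ∨ (canonicalFrame L).R 0 v w},
      fun o u v => (canonicalFrame L).R o u.1 v.1⟩
  have hsat : ∀ (ψ : Formula (Fin 2)) (x : F.X),
      Sat F (fun i => Subtype.val ⁻¹' canonicalVal L i) x ψ ↔
        Sat (canonicalFrame L) (canonicalVal L) x.1 ψ := by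
    refine sat_boundedMorphism (F := F) (G := canonicalFrame L) Subtype.val
      (fun o x y h => h) ?_
    rintro o ⟨x, hx⟩ z hxz
    refine ⟨⟨z, ?_⟩, hxz, rfl⟩
    have : (canonicalFrame L).R 0 x z ∨ (canonicalFrame L).R 0 z x := by
      fin_cases o
      · exact Or.inl hxz
      · exact Or.inr ((hconv _ _).1 hxz)
    rcases hx with hx | hx <;> rcases this with h | h
    · exact Or.inl (htr _ _ _ hx h)
    · exact (hlin1 _ _ _ hx h).symm
    · exact hlin0 _ _ _ hx h
    · exact Or.inr (htr _ _ _ h hx)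
  have htot : ∀ x y : F.X, (canonicalFrame L).R 0 x.1 y.1 ∨ (canonicalFrame L).R 0 y.1 x.1 := by
    rintro ⟨x, hx | hx⟩ ⟨y, hy | hy⟩
    · exact hlin0 _ _ _ hx hy
    · exact Or.inr (htr _ _ _ hy hx)
    · exact Or.inl (htr _ _ _ hx hy)
    · exact (hlin1 _ _ _ hx hy).symm
  refine ⟨F, _, ⟨fun o x => hrefl o x.1, fun o x y z => htrans o _ _ _, fun o x y => ?_,
    fun x y => hconv _ _⟩, fun ψ hψ x => (hsat ψ x).2 (sat_canonical_of_mem hL hψ _),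
    ⟨w, Or.inl (hrefl 0 w)⟩, fun h => hw ((hsat _ _).1 h)⟩
  fin_cases o
  · exact htot x y
  · exact ((htot y x).imp (hconv _ _).2 (hconv _ _).2)

end Tense

/-! ### Definable collapses onto chains and local tabularity. -/

section Chain

/-- The chain with `n` elements, with its converse. -/
def chain (n : ℕ) : KripkeFrame (Fin 2) where
  X := Fin n
  R o i j := if o = 0 then i ≤ j else j ≤ i

theorem chain_rel_one {n : ℕ} {i j : Fin n} : (chain n).R 1 i j ↔ j ≤ i := Iff.rfl

/-- A set that is a union of classes of points which agree on finitely many formulas is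
definable. -/
theorem exists_definition {O ι : Type} {F : KripkeFrame O} (θ : ℕ → Set F.X)
    (δ : ι → Formula O) (s : Finset ι) (S : Set F.X)
    (hS : ∀ x y, (∀ a ∈ s, Sat F θ x (δ a) ↔ Sat F θ y (δ a)) → x ∈ S → y ∈ S) :
    ∃ χ, ∀ x, Sat F θ x χ ↔ x ∈ S := by
  classical
  induction s using Finset.induction_on generalizing S with
  | empty =>
    by_cases h : ∃ x, x ∈ S
    · obtain ⟨x, hx⟩ := h
      exact ⟨Formula.neg .bot, fun y => iff_of_true id (hS x y (by simp) hx)⟩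
    · exact ⟨.bot, fun y => iff_of_false id fun hy => h ⟨y, hy⟩⟩
  | insert a s _ ih =>
    -- Split S by the truth value of `δ a` and saturate each half under agreement on `s`.
    obtain ⟨χ₁, h₁⟩ := ih {y | ∃ x ∈ S, Sat F θ x (δ a) ∧
      ∀ b ∈ s, Sat F θ x (δ b) ↔ Sat F θ y (δ b)}
      fun y z hyz ⟨x, hx, hxa, hxy⟩ => ⟨x, hx, hxa, fun b hb => (hxy b hb).trans (hyz b hb)⟩
    obtain ⟨χ₂, h₂⟩ := ih {y | ∃ x ∈ S, ¬ Sat F θ x (δ a) ∧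
      ∀ b ∈ s, Sat F θ x (δ b) ↔ Sat F θ y (δ b)}
      fun y z hyz ⟨x, hx, hxa, hxy⟩ => ⟨x, hx, hxa, fun b hb => (hxy b hb).trans (hyz b hb)⟩
    refine ⟨((δ a).and χ₁).or ((δ a).neg.and χ₂), fun y => ?_⟩
    simp only [sat_or, sat_and, sat_neg, h₁, h₂]
    constructor
    · rintro (⟨hy, x, hx, hxa, h⟩ | ⟨hy, x, hx, hxa, h⟩)
      all_goals
        refine hS x y (fun b hb => ?_) hx
        rcases Finset.mem_insert.1 hb with rfl | hb
        · tauto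
        · exact h b hb
    · intro hy
      by_cases hya : Sat F θ y (δ a)
      · exact Or.inl ⟨hya, y, hy, hya, fun _ _ => Iff.rfl⟩
      · exact Or.inr ⟨hya, y, hy, hya, fun _ _ => Iff.rfl⟩

variable {F : KripkeFrame (Fin 2)} {θ : ℕ → Set F.X}

/-- The formula `δ` defines an upset. -/
def IsUpFormula (F : KripkeFrame (Fin 2)) (θ : ℕ → Set F.X) (δ : Formula (Fin 2)) : Prop :=
  ∀ x y, F.R 0 x y → Sat F θ x δ → Sat F θ y δ

open Classical in
/-- The number of formulas `δ a` that are true at `x`. -/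
noncomputable def rank {ι : Type} [Fintype ι] (θ : ℕ → Set F.X) (δ : ι → Formula (Fin 2))
    (x : F.X) : ℕ :=
  (Finset.univ.filter fun a => Sat F θ x (δ a)).card

section Rank

variable {ι : Type} [Fintype ι] {δ : ι → Formula (Fin 2)} {x y : F.X}

theorem rank_le_card : rank θ δ x ≤ Fintype.card ι := by
  classical
  exact Finset.card_filter_le _ _

theorem rank_congr (h : ∀ a, Sat F θ x (δ a) ↔ Sat F θ y (δ a)) : rank θ δ x = rank θ δ y := by
  classical
  exact congrArg Finset.card (Finset.filter_congr fun a _ => h a)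

theorem rank_mono (hδ : ∀ a, IsUpFormula F θ (δ a)) (h : F.R 0 x y) :
    rank θ δ x ≤ rank θ δ y := by
  classical
  refine Finset.card_le_card fun a => ?_
  simpa using hδ a x y h

theorem rel_of_rank_lt (hF : IsLinear F) (hδ : ∀ a, IsUpFormula F θ (δ a))
    (h : rank θ δ x < rank θ δ y) : F.R 0 x y :=
  (hF.total 0 x y).resolve_right fun h' => absurd (rank_mono hδ h') (not_le.2 h)

/-- For comparable points the sets of true `δ a` are nested, so equal cardinality forces equality.
Thus the rank alone encodes the whole type. -/
theorem sat_iff_of_rank_eq (hF : IsLinear F) (hδ : ∀ a, IsUpFormula F θ (δ a))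
    (h : rank θ δ x = rank θ δ y) (a : ι) : Sat F θ x (δ a) ↔ Sat F θ y (δ a) := by
  classical
  have key : ∀ x y, F.R 0 x y → rank θ δ x = rank θ δ y →
      (Sat F θ x (δ a) ↔ Sat F θ y (δ a)) := by
    intro x y hxy h
    have := Finset.eq_of_subset_of_card_le (s := Finset.univ.filter fun a => Sat F θ x (δ a))
      (t := Finset.univ.filter fun a => Sat F θ y (δ a))
      (fun a => by simpa using hδ a x y hxy) h.ge
    simpa using Finset.ext_iff.1 this a
  rcases hF.total 0 x y with h' | h'
  · exact key x y h' h
  · exact (key y x h' h.symm).symm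

end Rank

/-- The points `x` and `y` satisfy the same formulas of the form `dia o χ`. -/
def ModalEquiv (θ : ℕ → Set F.X) (x y : F.X) : Prop :=
  ∀ o χ, Sat F θ x (.dia o χ) ↔ Sat F θ y (.dia o χ)

/-- The upset defined by a diamond: negate the diamonds that define downsets. -/
def upFormula (o : Fin 2) (χ : Formula (Fin 2)) : Formula (Fin 2) :=
  if o = 0 then (Formula.dia 0 χ).neg else .dia 1 χ

theorem isUpFormula_upFormula (hF : IsLinear F) (o : Fin 2) (χ : Formula (Fin 2)) :
    IsUpFormula F θ (upFormula o χ) := by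
  intro x y hxy
  by_cases ho : o = 0
  · simp only [upFormula, if_pos ho, sat_neg, sat_dia]
    exact fun h ⟨z, hyz, hz⟩ => h ⟨z, hF.trans _ _ _ _ hxy hyz, hz⟩
  · simp only [upFormula, if_neg ho, sat_dia]
    exact fun ⟨z, hxz, hz⟩ => ⟨z, hF.trans _ _ _ _ ((hF.converse _ _).2 hxy) hxz, hz⟩

theorem sat_upFormula_congr {x y : F.X} {o : Fin 2} {χ : Formula (Fin 2)} :
    (Sat F θ x (upFormula o χ) ↔ Sat F θ y (upFormula o χ)) ↔
      (Sat F θ x (.dia o χ) ↔ Sat F θ y (.dia o χ)) := by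
  fin_cases o
  · exact not_iff_not
  · exact Iff.rfl

/-- A linear model of `L` with `n` modally distinct points can be collapsed onto the chain with
`n` elements by a definable bounded morphism. -/
theorem valid_chain_of_not_modalEquiv {L : Set (Formula (Fin 2))} (hL : IsLogic L)
    (hF : IsLinear F) (hM : ∀ ψ ∈ L, ∀ x, Sat F θ x ψ) {n : ℕ} (p : Fin n → F.X)
    (hp : ∀ i j, i ≠ j → ¬ ModalEquiv θ (p i) (p j)) {ψ : Formula (Fin 2)} (hψ : ψ ∈ L) :
    Valid (chain n) ψ := by
  classical
  intro η c
  have hn : 0 < n := Fin.pos c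
  have hd : ∀ a : Fin n × Fin n, ∃ δ, IsUpFormula F θ δ ∧
      (a.1 ≠ a.2 → ¬ (Sat F θ (p a.1) δ ↔ Sat F θ (p a.2) δ)) := by
    -- Each pair is separated by an upset; on the diagonal ⊥ serves as a dummy.
    rintro ⟨i, j⟩
    by_cases hij : i = j
    · exact ⟨.bot, fun _ _ _ => id, fun h => absurd hij h⟩
    · have := hp i j hij
      simp only [ModalEquiv, not_forall] at this
      obtain ⟨o, χ, h⟩ := this
      exact ⟨upFormula o χ, isUpFormula_upFormula hF o χ,
        fun _ h' => h (sat_upFormula_congr.1 h')⟩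
  choose δ hδ hδp using hd
  have hinj : ∀ i j, rank θ δ (p i) = rank θ δ (p j) → i = j := fun i j h => by
    by_contra hij
    exact hδp (i, j) hij (sat_iff_of_rank_eq hF hδ h (i, j))
  -- The chosen points have distinct ranks, so counting those of smaller rank enumerates them as 0,
  -- …, n - 1.
  let cnt : F.X → ℕ := fun x => (Finset.univ.filter fun i => rank θ δ (p i) < rank θ δ x).card
  have hcnt : ∀ x y, rank θ δ x ≤ rank θ δ y → cnt x ≤ cnt y := fun x y h =>
    Finset.card_le_card fun i => by simpa using fun hi => hi.trans_le h
  have hcntp : ∀ i, cnt (p i) < n := fun i => by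
    have := Finset.card_lt_univ_of_notMem
      (s := Finset.univ.filter fun j => rank θ δ (p j) < rank θ δ (p i)) (x := i) (by simp)
    simpa using this
  have hcntlt : ∀ i j, rank θ δ (p i) < rank θ δ (p j) → cnt (p i) < cnt (p j) := by
    intro i j h
    refine Finset.card_lt_card (Finset.ssubset_iff.2 ⟨i, by simp, fun k => ?_⟩)
    simp only [Finset.mem_insert, Finset.mem_filter, Finset.mem_univ, true_and]
    rintro (rfl | hk)
    · exact h
    · exact hk.trans h
  -- Points ranked above all chosen ones have count n, hence the truncation at n - 1.
  let f : F.X → Fin n := fun x => ⟨min (cnt x) (n - 1), by omega⟩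
  have hfmono : ∀ x y, F.R 0 x y → f x ≤ f y := fun x y h =>
    min_le_min_right _ (hcnt x y (rank_mono hδ h))
  have hfsurj : Function.Surjective f := by
    have : Function.Injective fun i => f (p i) := by
      intro i j h
      have h₁ : min (cnt (p i)) (n - 1) = min (cnt (p j)) (n - 1) := congrArg Fin.val h
      have h₂ := hcntp i
      have h₃ := hcntp j
      refine hinj i j ?_
      rcases lt_trichotomy (rank θ δ (p i)) (rank θ δ (p j)) with h' | h' | h'
      · have := hcntlt _ _ h'; omega
      · exact h'
      · have := hcntlt _ _ h'; omega
    intro j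
    obtain ⟨i, hi⟩ := (Finite.injective_iff_surjective.1 this) j
    exact ⟨p i, hi⟩
  -- `f` depends only on the rank, so the pullback of any valuation of the chain is definable;
  -- closure of L under substitution then gives validity, not just truth in one model.
  have hdef : ∀ k, ∃ χ, ∀ x, Sat F θ x χ ↔ x ∈ f ⁻¹' η k := fun k => by
    refine exists_definition θ δ Finset.univ _ fun x y h hx => ?_
    have : rank θ δ x = rank θ δ y := rank_congr fun a => h a (Finset.mem_univ a)
    have : f y = f x := by simp only [f, cnt, this]
    exact (congrArg (· ∈ η k) this).mpr hx
  choose s hs using hdef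
  obtain ⟨x, rfl⟩ := hfsurj c
  have h₁ := hM _ (hL.subst s ψ hψ) x
  rw [sat_subst] at h₁
  have h₂ : (fun i => {y | Sat F θ y (s i)}) = fun i => f ⁻¹' η i := by
    funext i
    ext y
    exact hs i y
  rw [h₂] at h₁
  -- For f x < z any preimage of z works: by totality and monotonicity of `f` it lies above x.
  have hback0 : ∀ x z, f x ≤ z → ∃ y, F.R 0 x y ∧ f y = z := by
    intro x z hxz
    rcases hxz.eq_or_lt with rfl | hxz
    · exact ⟨x, hF.refl 0 x, rfl⟩
    · obtain ⟨y, rfl⟩ := hfsurj z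
      exact ⟨y, (hF.total 0 x y).resolve_right fun h => absurd (hfmono _ _ h) (not_le.2 hxz), rfl⟩
  have hback1 : ∀ x z, z ≤ f x → ∃ y, F.R 1 x y ∧ f y = z := by
    intro x z hxz
    rcases hxz.eq_or_lt with rfl | hxz
    · exact ⟨x, hF.refl 1 x, rfl⟩
    · obtain ⟨y, rfl⟩ := hfsurj z
      exact ⟨y, (hF.converse x y).2
        ((hF.total 0 y x).resolve_right fun h => absurd (hfmono _ _ h) (not_le.2 hxz)), rfl⟩
  refine (sat_boundedMorphism (G := chain n) f (fun o x y h => ?_) (fun o x z h => ?_) ψ x).1 h₁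
  · fin_cases o
    · exact hfmono x y h
    · exact hfmono y x ((hF.converse _ _).1 h)
  · fin_cases o
    · exact hback0 x z h
    · exact hback1 x z h

/-- The truth of `k`-formulas in a model with at most `n` classes of modal equivalence is
determined by a model on `Fin n × (Fin k → Prop)`. -/
theorem exists_quotient_model {n : ℕ} (e : F.X → Fin n)
    (he : ∀ x y, e x = e y → ModalEquiv θ x y) (k : ℕ) :
    ∃ (R : Fin 2 → Fin n × (Fin k → Prop) → Fin n × (Fin k → Prop) → Prop)
      (m : F.X → Fin n × (Fin k → Prop)), ∀ φ : Formula (Fin 2), φ.IsKFormula k → ∀ x,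
        (Sat ⟨Fin n × (Fin k → Prop), R⟩ (fun i => {q | ∃ h : i < k, q.2 ⟨i, h⟩}) (m x) φ ↔
          Sat F θ x φ) := by
  let m : F.X → Fin n × (Fin k → Prop) := fun x => (e x, fun i => x ∈ θ i)
  refine ⟨fun o q q' => ∃ x y, m x = q ∧ m y = q' ∧ F.R o x y, m, fun φ => ?_⟩
  induction φ with
  | var i =>
    intro hi x
    exact ⟨fun ⟨_, h⟩ => h, fun h => ⟨hi, h⟩⟩
  | bot => exact fun _ x => Iff.rfl
  | imp φ ψ h₁ h₂ =>
    intro hk x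
    rw [sat_imp, sat_imp, h₁ hk.1, h₂ hk.2]
  | dia o χ ih =>
    intro hk x
    constructor
    -- The quotient relation may use another representative x', but x and x' satisfy the same
    -- diamonds.
    · rintro ⟨q, ⟨x', y, hx', rfl, hxy⟩, hy⟩
      exact (he x' x (congrArg Prod.fst hx') o χ).1 ⟨y, hxy, (ih hk y).1 hy⟩
    · rintro ⟨y, hxy, hy⟩
      exact ⟨m y, ⟨x, y, rfl, rfl, hxy⟩, (ih hk y).2 hy⟩

/-- An extension of `LinT` that is refuted in a finite chain is locally tabular. -/
theorem locallyTabular_of_not_valid_chain {L : Set (Formula (Fin 2))} (hL : IsLogic L)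
    (hT : LinT ⊆ L) {n : ℕ} {ψ : Formula (Fin 2)} (hψ : ψ ∈ L) (hn : ¬ Valid (chain n) ψ) :
    LocallyTabular L := by
  intro k
  -- Truth sets in all models on the fixed finite carrier: only finitely many values are possible.
  let T : Formula (Fin 2) →
      (Fin 2 → Fin n × (Fin k → Prop) → Fin n × (Fin k → Prop) → Prop) →
        Set (Fin n × (Fin k → Prop)) := fun φ R =>
    {q | Sat ⟨Fin n × (Fin k → Prop), R⟩ (fun i => {q | ∃ h : i < k, q.2 ⟨i, h⟩}) q φ}
  have hequiv : ∀ φ χ : Formula (Fin 2), φ.IsKFormula k → χ.IsKFormula k → T φ = T χ →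
      LEquiv L φ χ := by
    intro φ χ hφ hχ h
    by_contra hne
    obtain ⟨F, θ, hF, hM, x, hx⟩ := exists_linear_model hL hT hne
    let r : Setoid F.X := ⟨ModalEquiv θ, fun _ _ _ => Iff.rfl, fun h o χ => (h o χ).symm,
      fun h h' o χ => (h o χ).trans (h' o χ)⟩
    -- Otherwise `Fin n` embeds in the quotient, giving n modally distinct points and hence validity
    -- of ψ in the n-chain.
    have hemb : Nonempty (Quotient r ↪ Fin n) := by
      refine (Function.Embedding.total (Quotient r) (Fin n)).resolve_right ?_
      rintro ⟨p⟩
      refine hn (valid_chain_of_not_modalEquiv hL hF hM (fun i => (p i).out)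
        (fun i j hij h => hij (p.injective ?_)) hψ)
      rw [← Quotient.out_eq (p i), ← Quotient.out_eq (p j)]
      exact Quotient.sound h
    obtain ⟨e⟩ := hemb
    obtain ⟨R, m, hm⟩ := exists_quotient_model (θ := θ) (fun x => e (Quotient.mk r x))
      (fun x y h => Quotient.exact (e.injective h)) k
    refine hx (sat_iff.2 ?_)
    rw [← hm φ hφ, ← hm χ hχ]
    exact Set.ext_iff.1 (congrFun h R) (m x)
  have htrans : ∀ φ χ ξ : Formula (Fin 2), LEquiv L φ χ → LEquiv L χ ξ → LEquiv L φ ξ := by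
    intro φ χ ξ h₁ h₂
    refine hL.mp _ _ (hL.mp _ _ (hL.taut _ fun v w => ?_) h₁) h₂
    simp only [Formula.propEval, Formula.iff, Formula.and, Formula.neg]
    tauto
  refine (Set.finite_range fun t => {ξ : Formula (Fin 2) | ξ.IsKFormula k ∧
    ∃ φ : Formula (Fin 2), φ.IsKFormula k ∧ T φ = t ∧ LEquiv L φ ξ}).subset ?_
  rintro C ⟨φ, hφ, rfl⟩
  refine ⟨T φ, Set.ext fun ξ => and_congr_right fun _ => ⟨?_, fun h => ⟨φ, hφ, rfl, h⟩⟩⟩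
  rintro ⟨χ, hχ, h, hχξ⟩
  exact htrans _ _ _ (hequiv φ χ hφ hχ h.symm) hχξ

end Chain

/-! ### Soundness for finite chains and failure of local tabularity. -/

section Soundness

theorem linTGrz_subset_log_chain (n : ℕ) : LinTGrz ⊆ Log {chain n} := by
  have hgrz : ∀ o : Fin 2, ∀ φ ∈ dotThree Grz, Valid (chain n) (φ.rename fun _ => o) := by
    intro o φ hφ
    -- An arbitrary linear order on `Fin n` covers both ≤ and ≥, hence both modalities.
    suffices h : ∀ R : Fin n → Fin n → Prop, IsLinearOrder (Fin n) R →
        φ ∈ Log {(⟨Fin n, fun _ => R⟩ : KripkeFrame Unit)} by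
      intro θ x
      rw [sat_rename]
      fin_cases o
      · exact h (· ≤ ·) inferInstance _ rfl θ x
      · exact h (· ≥ ·) inferInstance _ rfl θ x
    intro R hR
    refine hφ _ (isLogic_log _) (Set.union_subset (fun ψ hψ => ?_) (Set.singleton_subset_iff.2 ?_))
    · rintro _ rfl
      refine hψ _ ⟨fun x => refl_of R x, fun x y z => trans_of R, fun x y => antisymm_of R, ?_⟩
      have : IsTrans (Fin n) fun x y => R y x ∧ x ≠ y :=
        ⟨fun x y z h h' => ⟨trans_of R h'.1 h.1, fun hxz => h'.2 (antisymm_of R (hxz ▸ h.1) h'.1)⟩⟩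
      have : Std.Irrefl fun x y : Fin n => R y x ∧ x ≠ y := ⟨fun x h => h.2 rfl⟩
      exact Finite.wellFounded_of_trans_of_irrefl _
    · rintro _ rfl θ x
      simp only [linAxiom, sat_imp, sat_and, sat_or, sat_dia]
      rintro ⟨⟨y, hxy, hy⟩, z, hxz, hz⟩
      rcases total_of R y z with h | h
      · exact Or.inl ⟨y, hxy, hy, z, h, hz⟩
      · exact Or.inr ⟨z, hxz, hz, y, h, hy⟩
  refine smallestLogic_subset (isLogic_log _) (Set.union_subset
    (smallestLogic_subset (isLogic_log _) (Set.union_subset ?_ ?_))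
    (Set.singleton_subset_iff.2 ?_))
  · rintro _ ⟨φ, hφ, rfl⟩ _ rfl
    exact hgrz 0 φ hφ
  · rintro _ ⟨φ, hφ, rfl⟩ _ rfl
    exact hgrz 1 φ hφ
  · rintro _ rfl θ x
    simp only [conv, sat_and, sat_imp, sat_dia, sat_box]
    exact ⟨fun ⟨y, hxy, h⟩ => h x hxy, fun ⟨y, hxy, h⟩ => h x hxy⟩

/-- The formula `p_0` if `i` is even, and its negation if `i` is odd. -/
def parityFormula (i : ℕ) : Formula (Fin 2) :=
  if i % 2 = 0 then .var 0 else (Formula.var 0).neg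

/-- There are `i` alternations of `p_0` and its negation below the current point. -/
def alternation : ℕ → Formula (Fin 2)
  | 0 => parityFormula 0
  | i + 1 => (parityFormula (i + 1)).and (.dia 1 (alternation i))

theorem isKFormula_parityFormula (i : ℕ) : (parityFormula i).IsKFormula 1 := by
  unfold parityFormula
  split <;> simp [Formula.IsKFormula, Formula.neg]

theorem isKFormula_alternation (i : ℕ) : (alternation i).IsKFormula 1 := by
  induction i with
  | zero => exact isKFormula_parityFormula 0
  | succ i ih => simp [alternation, Formula.and, Formula.neg, Formula.IsKFormula, ih,
      isKFormula_parityFormula]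

/-- The valuation that makes `p_0` true at the even points. -/
def evenVal (n : ℕ) : ℕ → Set (chain n).X :=
  fun _ => {t : Fin n | t.1 % 2 = 0}

theorem sat_parityFormula {n : ℕ} (i : ℕ) (t : Fin n) :
    Sat (chain n) (evenVal n) t (parityFormula i) ↔ t.1 % 2 = i % 2 := by
  have h : Sat (chain n) (evenVal n) t (.var 0) ↔ t.1 % 2 = 0 := Iff.rfl
  unfold parityFormula
  split
  · rw [h]; omega
  · exact (not_congr h).trans (by omega)

/-- Consecutive witnesses have opposite parity, so each weak step down is strict. -/
theorem le_of_sat_alternation {n : ℕ} (i : ℕ) (t : Fin n)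
    (h : Sat (chain n) (evenVal n) t (alternation i)) : i ≤ t.1 := by
  induction i generalizing t with
  | zero => exact Nat.zero_le _
  | succ i ih =>
    obtain ⟨h₁, s, hs, h₂⟩ := sat_and.1 h
    have h₃ : s.1 ≤ t.1 := chain_rel_one.1 hs
    have h₄ := (sat_parityFormula _ t).1 h₁
    have h₅ := ih s h₂
    have h₆ : s.1 % 2 = i % 2 := by
      cases i with
      | zero => exact (sat_parityFormula _ s).1 h₂
      | succ i => exact (sat_parityFormula _ s).1 (sat_and.1 h₂).1
    omega

theorem sat_alternation {n : ℕ} (i : ℕ) (hi : i < n) :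
    Sat (chain n) (evenVal n) (⟨i, hi⟩ : Fin n) (alternation i) := by
  induction i with
  | zero => exact (sat_parityFormula 0 (⟨0, hi⟩ : Fin n)).2 rfl
  | succ i ih =>
    refine sat_and.2 ⟨(sat_parityFormula _ (⟨i + 1, hi⟩ : Fin n)).2 rfl,
      (⟨i, by omega⟩ : Fin n), chain_rel_one.2 ?_, ih (by omega)⟩
    exact Fin.mk_le_mk.2 (Nat.le_succ i)

theorem not_locallyTabular_linTGrz : ¬ LocallyTabular LinTGrz := by
  intro h
  have hne : ∀ i j, i < j → ¬ LEquiv LinTGrz (alternation j) (alternation i) := by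
    intro i j hij h
    -- The top of the chain with i + 1 points has room for i alternations but not for j > i.
    let t : Fin (i + 1) := ⟨i, Nat.lt_succ_self i⟩
    have h₁ := sat_iff.1 (linTGrz_subset_log_chain (i + 1) h _ rfl (evenVal _) t)
    exact absurd (le_of_sat_alternation j t (h₁.2 (sat_alternation i t.2))) (not_le.2 hij)
  have hself : ∀ φ, LEquiv LinTGrz φ φ := fun φ => (isLogic_smallestLogic _).taut _ fun v w => by
    simp only [Formula.propEval, Formula.iff, Formula.and, Formula.neg]
    tauto
  refine Set.infinite_of_injective_forall_mem (s := equivClasses LinTGrz 1)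
    (f := fun i => {ψ | ψ.IsKFormula 1 ∧ LEquiv LinTGrz (alternation i) ψ}) (fun i j hij => ?_)
    (fun i => ⟨alternation i, isKFormula_alternation i, rfl⟩) (h 1)
  have h₁ : ∀ i j, {ψ : Formula (Fin 2) | ψ.IsKFormula 1 ∧ LEquiv LinTGrz (alternation i) ψ} =
      {ψ : Formula (Fin 2) | ψ.IsKFormula 1 ∧ LEquiv LinTGrz (alternation j) ψ} → ¬ i < j :=
    fun i j he hlt => hne i j hlt
      ((Set.ext_iff.1 he (alternation i)).1 ⟨isKFormula_alternation i, hself _⟩).2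
  exact le_antisymm (not_lt.1 (h₁ j i hij.symm)) (not_lt.1 (h₁ i j hij))

end Soundness

/-! ### Completeness of `LinTGrz` for finite chains. -/

section Completeness

open Formula in
/-- The Grzegorczyk formula `p → ◇(p ∧ ¬◇(¬p ∧ ◇p))`. -/
def grzAxiom : Formula Unit :=
  imp (var 0) (dia () ((var 0).and (neg (dia () ((neg (var 0)).and (dia () (var 0)))))))

/-- A maximal p-point above x is a witness: leaving p and returning would give a strictly higher
one. -/
theorem grzAxiom_mem_grz : grzAxiom ∈ Grz := by
  rintro F ⟨hrefl, htrans, hanti, hwf⟩ θ x hx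
  obtain ⟨y, ⟨hxy, hy⟩, hmax⟩ := hwf.has_min {y | F.R () x y ∧ y ∈ θ 0} ⟨x, hrefl x, hx⟩
  refine ⟨y, hxy, sat_and.2 ⟨hy, ?_⟩⟩
  rintro ⟨z, hyz, h⟩
  obtain ⟨hz, u, hzu, hu⟩ := sat_and.1 h
  have hyu := htrans _ _ _ hyz hzu
  have : u = y := by
    by_contra hne
    exact hmax u ⟨htrans _ _ _ hxy hyu, hu⟩ ⟨hyu, hne⟩
  subst this
  rw [hanti _ _ hzu hyz] at hz
  exact hz hu

/-- In a linear model of `LinTGrz`, every formula true at `x` is true at a point accessible from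
`x` after which it never becomes true again once it has become false. -/
theorem exists_final_of_linTGrz {F : KripkeFrame (Fin 2)} {θ : ℕ → Set F.X}
    (hM : ∀ ψ ∈ LinTGrz, ∀ x, Sat F θ x ψ) (o : Fin 2) (χ : Formula (Fin 2)) (x : F.X)
    (hx : Sat F θ x χ) : ∃ y, F.R o x y ∧ Sat F θ y χ ∧
      ∀ z u, F.R o y z → F.R o z u → Sat F θ u χ → Sat F θ z χ := by
  have h := hM _ ((isLogic_smallestLogic _).subst (fun _ => χ) _
    (rename_mem_addAxiom_fusion (mem_dotThree grzAxiom_mem_grz) o)) x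
  rw [sat_subst, sat_rename] at h
  simp only [grzAxiom, sat_imp, sat_dia, sat_and, sat_neg, sat_var, Set.mem_ofPred_eq] at h
  obtain ⟨y, hxy, hy, h⟩ := h hx
  refine ⟨y, hxy, hy, fun z u hyz hzu hu => ?_⟩
  by_contra hz
  exact h ⟨z, hyz, hz, u, hzu, hu⟩

/-- A linear preorder split into finitely many intervals by `rk`: each interval has a point that
belongs to all the sets of the list `l` that are cofinal in it. -/
theorem exists_last {X : Type} [Nonempty X] {R : X → X → Prop} (hrefl : ∀ x, R x x)
    (htrans : ∀ x y z, R x y → R y z → R x z) (htot : ∀ x y, R x y ∨ R y x) {rk : X → ℕ} {N : ℕ}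
    (hN : ∀ x, rk x ≤ N) (hmono : ∀ x y, R x y → rk x ≤ rk y) (l : List (Set X))
    (hl : ∀ A ∈ l, ∀ x y, rk x = rk y → (∃ z, R x z ∧ z ∈ A) → ∃ z, R y z ∧ z ∈ A)
    (hfin : ∀ A ∈ l, ∀ x ∈ A, ∃ y, R x y ∧ y ∈ A ∧ rk y = rk x ∧
      ∀ z u, R y z → R z u → u ∈ A → rk u = rk x → z ∈ A) :
    ∃ last : ℕ → X, ∀ x, rk (last (rk x)) = rk x ∧
      ∀ A ∈ l, (∃ y, R x y ∧ y ∈ A) → ∃ y, R x y ∧ last (rk y) ∈ A := by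
  let Cof : Set X → ℕ → Prop := fun A r => ∀ x, rk x = r → ∃ y, R x y ∧ rk y = r ∧ y ∈ A
  -- Move y forward for each cofinal A in turn, to a point after which A cannot be left and
  -- re-entered within the interval; cofinality then means it is never left.
  have hblock : ∀ l', l' ⊆ l → ∀ x, ∃ y, rk y = rk x ∧
      ∀ A ∈ l', Cof A (rk x) → ∀ z, R y z → rk z = rk x → z ∈ A := by
    intro l' hl' x
    induction l' with
    | nil => exact ⟨x, rfl, by simp⟩
    | cons A l' ih =>
      obtain ⟨y, hy, hyl⟩ := ih fun B hB => hl' (List.mem_cons_of_mem _ hB)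
      by_cases hA : Cof A (rk x)
      · obtain ⟨z, hyz, hz, hzA⟩ := hA y hy
        obtain ⟨y', hzy, -, hy', hyA⟩ := hfin A (hl' List.mem_cons_self) z hzA
        refine ⟨y', hy'.trans hz, fun B hB hBc z' hyz' hz' => ?_⟩
        rcases List.mem_cons.1 hB with rfl | hB
        · obtain ⟨u, hzu, hu, huA⟩ := hA z' hz'
          exact hyA z' u hyz' hzu huA (hu.trans hz.symm)
        · exact hyl B hB hBc z' (htrans _ _ _ hyz (htrans _ _ _ hzy hyz')) hz'
      · refine ⟨y, hy, fun B hB hBc => ?_⟩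
        rcases List.mem_cons.1 hB with rfl | hB
        · exact absurd hBc hA
        · exact hyl B hB hBc
  have hlast : ∀ r, ∃ y, ∀ x, rk x = r → rk y = r ∧ ∀ A ∈ l, Cof A r → y ∈ A := by
    intro r
    by_cases h : ∃ x, rk x = r
    · obtain ⟨x, rfl⟩ := h
      obtain ⟨y, hy, hyl⟩ := hblock l (List.Subset.refl l) x
      exact ⟨y, fun _ _ => ⟨hy, fun A hA hc => hyl A hA hc y (hrefl y) hy⟩⟩
    · exact ⟨Classical.arbitrary X, fun x hx => absurd ⟨x, hx⟩ h⟩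
  choose last hlast using hlast
  refine ⟨last, fun x => ⟨(hlast _ x rfl).1, fun A hA hx => ?_⟩⟩
  -- Take a witness in A of greatest rank. By `hl` every point of its interval sees A, and
  -- maximality keeps such witnesses inside the interval, so A is cofinal there.
  obtain ⟨y, ⟨hxy, hy⟩, hmin⟩ :=
    (measure fun y => N - rk y).wf.has_min {y | R x y ∧ y ∈ A} hx
  refine ⟨y, hxy, (hlast _ y rfl).2 A hA fun x' hx' => ?_⟩
  obtain ⟨z, hxz, hz⟩ := hl A hA y x' hx'.symm ⟨y, hrefl y, hy⟩
  refine ⟨z, hxz, ?_, hz⟩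
  have h₁ := hmono _ _ hxz
  by_contra hne
  have hyz : R y z := (htot y z).resolve_right fun h => by
    have := hmono _ _ h
    omega
  refine hmin z ⟨htrans _ _ _ hxy hyz, hz⟩ ?_
  have h₂ := hN z
  change N - rk z < N - rk y
  omega

/-- The diamond subformulas of a formula. -/
def diamonds : Formula (Fin 2) → List (Fin 2 × Formula (Fin 2))
  | .var _ => []
  | .bot => []
  | .imp φ ψ => diamonds φ ++ diamonds ψ
  | .dia o φ => (o, φ) :: diamonds φ

/-- `LinTGrz` is complete with respect to finite chains. -/
theorem mem_linTGrz_of_valid_chain {φ : Formula (Fin 2)} (h : ∀ n, Valid (chain n) φ) :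
    φ ∈ LinTGrz := by
  classical
  by_contra hφ
  obtain ⟨F, θ, hF, hM, w, hw⟩ :=
    exists_linear_model (isLogic_smallestLogic _) linT_subset_linTGrz hφ
  have : Nonempty F.X := ⟨w⟩
  let δ : Fin (diamonds φ).length → Formula (Fin 2) := fun a =>
    upFormula ((diamonds φ).get a).1 ((diamonds φ).get a).2
  have hδ : ∀ a, IsUpFormula F θ (δ a) := fun a => isUpFormula_upFormula hF _ _
  obtain ⟨rk, hrk⟩ : ∃ rk, rk = rank θ δ := ⟨_, rfl⟩
  obtain ⟨N, hN⟩ : ∃ N, ∀ x, rk x ≤ N := ⟨_, fun x => by rw [hrk]; exact rank_le_card⟩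
  have hmono : ∀ x y, F.R 0 x y → rk x ≤ rk y := fun x y h => by
    rw [hrk]; exact rank_mono hδ h
  have hlt : ∀ x y, rk x < rk y → F.R 0 x y := fun x y h => by
    rw [hrk] at h; exact rel_of_rank_lt hF hδ h
  have hcongr : ∀ x y, rk x = rk y → ∀ o χ, (o, χ) ∈ diamonds φ →
      (Sat F θ x (.dia o χ) ↔ Sat F θ y (.dia o χ)) := by
    intro x y hxy o χ hχ
    obtain ⟨a, ha⟩ := List.mem_iff_get.1 hχ
    rw [hrk] at hxy
    have h₁ : δ a = upFormula o χ := by simp only [δ, ha]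
    have h₂ := sat_iff_of_rank_eq hF hδ hxy a
    rw [h₁] at h₂
    exact sat_upFormula_congr.1 h₂
  let l : Fin 2 → List (Set F.X) := fun o =>
    ((diamonds φ).filter fun a => a.1 = o).map fun a => {x | Sat F θ x a.2}
  have hmem : ∀ o A, A ∈ l o ↔ ∃ χ, (o, χ) ∈ diamonds φ ∧ {x | Sat F θ x χ} = A := by
    intro o A
    simp only [l, List.mem_map, List.mem_filter, decide_eq_true_eq]
    constructor
    · rintro ⟨⟨_, χ⟩, ⟨hχ, rfl⟩, hA⟩
      exact ⟨χ, hχ, hA⟩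
    · rintro ⟨χ, hχ, hA⟩
      exact ⟨(o, χ), ⟨hχ, rfl⟩, hA⟩
  have hl : ∀ o, ∀ A ∈ l o, ∀ x y, rk x = rk y →
      (∃ z, F.R o x z ∧ z ∈ A) → ∃ z, F.R o y z ∧ z ∈ A := by
    intro o A hA x y hxy
    obtain ⟨χ, hχ, rfl⟩ := (hmem o A).1 hA
    exact (hcongr x y hxy o χ hχ).1
  have hfin : ∀ o, ∀ A ∈ l o, ∀ x ∈ A, ∃ y, F.R o x y ∧ y ∈ A ∧ rk y = rk x ∧
      ∀ z u, F.R o y z → F.R o z u → u ∈ A → rk u = rk x → z ∈ A := by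
    intro o A hA x hx
    obtain ⟨χ, hχ, rfl⟩ := (hmem o A).1 hA
    -- β defines the interval of x; applying the Grzegorczyk property to β ∧ χ keeps the final point
    -- inside it.
    obtain ⟨β, hβ⟩ := exists_definition θ δ Finset.univ {y | rk y = rk x} fun y z hyz hy => by
      rw [Set.mem_ofPred_eq, hrk] at hy ⊢
      rw [← hy]
      exact rank_congr fun a => (hyz a (Finset.mem_univ a)).symm
    obtain ⟨y, hxy, hy, hyf⟩ := exists_final_of_linTGrz hM o (β.and χ) x
      (sat_and.2 ⟨(hβ x).2 rfl, hx⟩)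
    exact ⟨y, hxy, (sat_and.1 hy).2, (hβ y).1 (sat_and.1 hy).1, fun z u hyz hzu hu hru =>
      (sat_and.1 (hyf z u hyz hzu (sat_and.2 ⟨(hβ u).2 hru, hu⟩))).2⟩
  obtain ⟨last, hlast⟩ := exists_last (hF.refl 0) (hF.trans 0) (hF.total 0) hN hmono (l 0)
    (hl 0) (hfin 0)
  -- The same lemma for the converse order, with ranks reversed to N - rk; hence `first` is indexed
  -- by the reversed rank.
  obtain ⟨first, hfirst⟩ := exists_last (rk := fun x => N - rk x) (hF.refl 1) (hF.trans 1)
    (hF.total 1) (fun x => Nat.sub_le N _)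
    (fun x y hxy => Nat.sub_le_sub_left (hmono y x ((hF.converse x y).1 hxy)) N) (l 1)
    (fun A hA x y hxy => hl 1 A hA x y (by have := hN x; have := hN y; omega))
    (fun A hA x hx => by
      obtain ⟨y, hxy, hy, hyr, h⟩ := hfin 1 A hA x hx
      refine ⟨y, hxy, hy, by rw [hyr], fun z u hyz hzu hu hru => h z u hyz hzu hu ?_⟩
      have := hN x
      have := hN u
      omega)
  -- Three slots per interval r: 3r for its first point, 3r + 2 for its last, and 3r + 1 for w in
  -- the interval of w, so that the refuting point survives (elsewhere it repeats the last point).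
  let pt : ℕ → F.X := fun k =>
    if k % 3 = 0 then first (N - k / 3) else if k % 3 = 1 ∧ k / 3 = rk w then w
      else last (k / 3)
  -- Slots of empty intervals are discarded.
  let S : Finset ℕ := (Finset.range (3 * (N + 1))).filter fun k => ∃ x, rk x = k / 3
  have hpt : ∀ k ∈ S, rk (pt k) = k / 3 := by
    intro k hk
    obtain ⟨x, hx⟩ := (Finset.mem_filter.1 hk).2
    simp only [pt]
    split_ifs with h₁ h₂
    · have h₃ : N - rk (first (N - rk x)) = N - rk x := (hfirst x).1
      have h₄ := hN x
      have h₅ := hN (first (N - rk x))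
      rw [← hx]
      omega
    · exact h₂.2.symm
    · rw [← hx]
      exact (hlast x).1
  have hS : ∀ x i, i < 3 → 3 * rk x + i ∈ S := by
    intro x i hi
    have := hN x
    exact Finset.mem_filter.2 ⟨Finset.mem_range.2 (by omega), x, by omega⟩
  let e : Fin S.card ≃o S := S.orderIsoOfFin rfl
  let g : Fin S.card → F.X := fun i => pt (e i)
  have hg : ∀ i, rk (g i) = (e i : ℕ) / 3 := fun i => hpt _ (e i).2
  have hgle : ∀ i j, i ≤ j → rk (g i) ≤ rk (g j) := by
    intro i j hij
    rw [hg, hg]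
    exact Nat.div_le_div_right (e.monotone hij)
  have hge : ∀ x i (hi : i < 3), g (e.symm ⟨3 * rk x + i, hS x i hi⟩) = pt (3 * rk x + i) := by
    intro x i hi
    simp only [g, OrderIso.apply_symm_apply]
  have truth : ∀ χ : Formula (Fin 2), diamonds χ ⊆ diamonds φ → ∀ i : Fin S.card,
      (Sat (chain S.card) (fun j => g ⁻¹' θ j) i χ ↔ Sat F θ (g i) χ) := by
    intro χ
    induction χ with
    | var j => exact fun _ i => Iff.rfl
    | bot => exact fun _ i => Iff.rfl
    | imp χ ξ h₁ h₂ =>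
      intro hs i
      obtain ⟨hs₁, hs₂⟩ := List.append_subset.1 hs
      exact imp_congr (h₁ hs₁ i) (h₂ hs₂ i)
    | dia o χ ih =>
      intro hs i
      obtain ⟨hχ, hs'⟩ := List.cons_subset.1 hs
      fin_cases o
      · constructor
        · rintro ⟨j, hij, hj⟩
          have hj' := (ih hs' j).1 hj
          -- Within an interval the order of slots need not match that of F, but there the diamonds
          -- of φ have constant truth value; reflexivity then suffices.
          rcases (hgle i j hij).eq_or_lt with h' | h'
          · exact (hcongr _ _ h' 0 χ hχ).2 ⟨g j, hF.refl 0 _, hj'⟩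
          · exact ⟨g j, hlt _ _ h', hj'⟩
        · intro hi
          obtain ⟨y, hxy, hy⟩ := (hlast (g i)).2 _ ((hmem 0 _).2 ⟨χ, hχ, rfl⟩) hi
          -- The last slot of the interval of y comes after every slot of rank at most that of y,
          -- including i.
          refine ⟨e.symm ⟨3 * rk y + 2, hS y 2 (by omega)⟩, ?_, ?_⟩
          · refine (OrderIso.le_symm_apply e).2 (Subtype.coe_le_coe.1 ?_)
            have h₁ := hmono _ _ hxy
            have h₂ := hg i
            change (e i : ℕ) ≤ 3 * rk y + 2
            omega
          · refine (ih hs' _).2 ?_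
            rw [hge y 2 (by omega)]
            have : pt (3 * rk y + 2) = last (rk y) := by
              simp only [pt]
              rw [if_neg (by omega), if_neg (by omega)]
              congr 1
              omega
            rw [this]
            exact hy
      · constructor
        · rintro ⟨j, hij, hj⟩
          have hj' := (ih hs' j).1 hj
          rcases (hgle j i hij).eq_or_lt with h' | h'
          · exact (hcongr _ _ h' 1 χ hχ).1 ⟨g j, hF.refl 1 _, hj'⟩
          · exact ⟨g j, (hF.converse _ _).2 (hlt _ _ h'), hj'⟩
        · intro hi
          obtain ⟨y, hxy, hy⟩ := (hfirst (g i)).2 _ ((hmem 1 _).2 ⟨χ, hχ, rfl⟩) hi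
          refine ⟨e.symm ⟨3 * rk y + 0, hS y 0 (by omega)⟩, ?_, ?_⟩
          · refine (OrderIso.symm_apply_le e).2 (Subtype.coe_le_coe.1 ?_)
            have h₁ := hmono _ _ ((hF.converse _ _).1 hxy)
            have h₂ := hg i
            change 3 * rk y + 0 ≤ (e i : ℕ)
            omega
          · refine (ih hs' _).2 ?_
            rw [hge y 0 (by omega)]
            have : pt (3 * rk y + 0) = first (N - rk y) := by
              simp only [pt]
              rw [if_pos (by omega)]
              congr 2
              omega
            rw [this]
            exact hy
  refine hw ?_
  have hgw : g (e.symm ⟨3 * rk w + 1, hS w 1 (by omega)⟩) = w := by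
    rw [hge w 1 (by omega)]
    simp only [pt]
    rw [if_neg (by omega), if_pos (by omega)]
  have := (truth φ (List.Subset.refl _) (e.symm ⟨3 * rk w + 1, hS w 1 (by omega)⟩)).1 (h _ _ _)
  rwa [hgw] at this

end Completeness
end ModalLog

theorem mainTheorem7 :
    (∀ L : Set (ModalLog.Formula (Fin 2)), ModalLog.IsLogic L → ModalLog.LinT ⊆ L →
      ModalLog.LocallyTabular L ∨ L ⊆ ModalLog.LinTGrz) ∧
    ModalLog.PreLocallyTabular ModalLog.LinTGrz := by
  have main : ∀ L : Set (ModalLog.Formula (Fin 2)), ModalLog.IsLogic L → ModalLog.LinT ⊆ L →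
      ModalLog.LocallyTabular L ∨ L ⊆ ModalLog.LinTGrz := by
    intro L hL hT
    refine or_iff_not_imp_left.2 fun h φ hφ => ModalLog.mem_linTGrz_of_valid_chain fun n => ?_
    by_contra hn
    exact h (ModalLog.locallyTabular_of_not_valid_chain hL hT hφ hn)
  exact ⟨main, ModalLog.isLogic_smallestLogic _, ModalLog.not_locallyTabular_linTGrz,
    fun L hL hlt => (main L hL (ModalLog.linT_subset_linTGrz.trans hlt.subset)).resolve_right
      hlt.not_subset⟩
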